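/- A system of linear equations over $\mathbb F_2$ in variables $X_1,\dots,X_n$ is called a homogeneous 3-XOR system if it is a finite set of equations of the form $X+Y+Z=0$ with $X,Y,Z$ three distinct variables. Let $\varphi$ be such a system and, for $1\le i\le n$, let $\varphi_i$ be the system obtained from $\varphi$ by adding the equation $X_i=1$. **Local consistency.** For a system $\psi$ and an integer $K$, consider the following game of Spoiler and Verifier with $K$ pebbles, none of which is in play at the start. In each move Spoiler chooses a pebble (in play or fresh) and places it on a variable $X$ appearing in $\psi$, and Verifier answers with a value in $\{0,1\}$ for $X$. Spoiler wins if, as a result, a variable carries two different values, or there is an equation of $\psi$ all of whose variables are pebbled and which is violated by the values on them. The system $\psi$ is $K$-locally consistent if Verifier has a strategy to play forever without losing. **The graph $G_\varphi$.** It is the simple undirected graph with the following vertices: for each variable $X$ two vertices $X^0,X^1$; for each equation $X+Y+Z=0$ of $\varphi$ four vertices, one for each way of negating an even number (none or two) of $X,Y,Z$; and for each $j$ with $1\le j<n$ three vertices $j_l,j_r,j_s$. Its edges are: $X^0X^1$ for each variable $X$; for each vertex of an equation and each variable $X$ of that equation, an edge to $X^1$ if $X$ is not negated and to $X^0$ if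 $X$ is negated; and, for each $1\le j<n$, the edges $j_lj_r$, $j_rj_s$, $j_lX_j^0$, $j_lX_j^1$, $j_rX_{j+1}^0$, $j_rX_{j+1}^1$. **The equivalence $\equiv^k$.** For a finite graph $G$ with vertex set $V$ and an integer $k\ge 2$, let $\equiv^k$ be the equivalence relation on $V^k$ given by the coarsest partition $\mathcal P$ of $V^k$ such that, whenever $u,v\in V^k$ lie in the same part and $P_1,\dots,P_k\in\mathcal P$, the map $u_a\mapsto v_a$ is an isomorphism between the subgraphs of $G$ induced by $u$ and by $v$, and $$|\{x\in V : u[x/a]\in P_a \text{ for } 1\le a\le k\}| = |\{x\in V : v[x/a]\in P_a \text{ for } 1\le a\le k\}|,$$ where $u[x/a]$ is $u$ with its $a$-th entry replaced by $x$. For single vertices, $x\equiv^k y$ means $(x,\dots,x)\equiv^k(y,\dots,y)$. **Lemma.** Let $\varphi$ be a homogeneous 3-XOR system in the variables $X_1,\dots,X_n$, let $1\le i\le n$ and let $k\ge 2$. If $\varphi_i$ is $3(k+1)$-locally consistent, then $X_i^0\equiv^k X_i^1$ in $G_\varphi$. -/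

import Mathlib

/-- A linear equation `∑ X ∈ support, X = rhs` over the two-element field,
in the variables `X_0, …, X_{n-1}`. -/
structure XorEq (n : ℕ) where
  support : Finset (Fin n)
  rhs : ZMod 2
deriving DecidableEq

/-- A finite system of linear equations over the two-element field in `n` variables. -/
abbrev XorSystem (n : ℕ) := Finset (XorEq n)

namespace XorSystem

variable {n : ℕ}

/-- Every equation contains exactly three variables. -/
def IsThreeXor (φ : XorSystem n) : Prop := ∀ e ∈ φ, e.support.card = 3

/-- Every right-hand side is `0`. -/
def IsHomogeneous (φ : XorSystem n) : Prop := ∀ e ∈ φ, e.rhs = 0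

/-- The variable `X` occurs in some equation of `φ`. -/
def Appears (φ : XorSystem n) (X : Fin n) : Prop := ∃ e ∈ φ, X ∈ e.support

/-- The system `φ` with the equation `X_i = 1` added. -/
def addEqOne (φ : XorSystem n) (i : Fin n) : XorSystem n := insert ⟨{i}, 1⟩ φ

/-! ### The local consistency game -/

/-- A position of the game with `K` pebbles: each pebble is either not in play (`none`), or it lies
on a variable for which Verifier has chosen a value. -/
abbrev Position (K n : ℕ) := Fin K → Option (Fin n × ZMod 2)

/-- Spoiler has not won in the position `p`: the values chosen by Verifier form a partial
assignment (no variable carries two values), and every equation all of whose variables are pebbled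
is satisfied by that assignment. -/
def Position.Safe {K : ℕ} (φ : XorSystem n) (p : Position K n) : Prop :=
  (∀ (a b : Fin K) (X : Fin n) (s t : ZMod 2), p a = some (X, s) → p b = some (X, t) → s = t) ∧
  ∀ e ∈ φ, ∀ T : Fin n → ZMod 2, (∀ X ∈ e.support, ∃ a, p a = some (X, T X)) →
    ∑ X ∈ e.support, T X = e.rhs

/-- A move of Spoiler: a pebble and the variable on which it is placed. -/
abbrev Move (K n : ℕ) := Fin K × Fin n

/-- A strategy of Verifier: the value answered to the latest move of Spoiler, given all the moves
of Spoiler so far, the latest one first. -/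
abbrev Strategy (K n : ℕ) := List (Move K n) → ZMod 2

/-- The position reached from the empty one when Spoiler has made the given moves (latest first)
and Verifier has answered according to `σ`. -/
def Strategy.position {K : ℕ} (σ : Strategy K n) : List (Move K n) → Position K n
  | [] => fun _ => none
  | m :: h => Function.update (Strategy.position σ h) m.1 (some (m.2, σ (m :: h)))

/-- Verifier has a strategy to play the `K`-pebble game on `φ` forever without losing. -/
def LocallyConsistent (K : ℕ) (φ : XorSystem n) : Prop :=
  ∃ σ : Strategy K n, ∀ h : List (Move K n), (∀ m ∈ h, φ.Appears m.2) → (σ.position h).Safe φ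

/-! ### The graph of a system -/

/-- The clauses giving rise to an equation of `φ`: such a clause is an equation `e` of `φ` together
with the set `s` of those of its variables that occur negated, where the parity of the number of
negated variables is the right-hand side of `e`. If `e` has three variables there are four of
them. -/
def Clause (φ : XorSystem n) : Type :=
  {c : XorEq n × Finset (Fin n) // c.1 ∈ φ ∧ c.2 ⊆ c.1.support ∧ (c.2.card : ZMod 2) = c.1.rhs}

/-- The vertices of the graph of `φ`: the clauses, the vertices `X^0` and `X^1` for each variable
`X`, and three vertices for each pair of consecutive variables `X_j, X_{j+1}`. -/
inductive Vertex (φ : XorSystem n) : Type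
  | clause (c : φ.Clause)
  | var (X : Fin n) (b : ZMod 2)
  | left (j : ℕ) (hj : j + 1 < n)
  | right (j : ℕ) (hj : j + 1 < n)
  | stub (j : ℕ) (hj : j + 1 < n)

/-- The edges of the graph of `φ`, each in one direction. -/
inductive Edge (φ : XorSystem n) : φ.Vertex → φ.Vertex → Prop
  | pos (c : φ.Clause) (X : Fin n) (hX : X ∈ c.1.1.support) (hs : X ∉ c.1.2) :
      Edge φ (.clause c) (.var X 1)
  | neg (c : φ.Clause) (X : Fin n) (hX : X ∈ c.1.1.support) (hs : X ∈ c.1.2) :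
      Edge φ (.clause c) (.var X 0)
  | pair (X : Fin n) : Edge φ (.var X 0) (.var X 1)
  | left_right (j : ℕ) (hj : j + 1 < n) : Edge φ (.left j hj) (.right j hj)
  | right_stub (j : ℕ) (hj : j + 1 < n) : Edge φ (.right j hj) (.stub j hj)
  | left_var (j : ℕ) (hj : j + 1 < n) (b : ZMod 2) :
      Edge φ (.left j hj) (.var ⟨j, Nat.lt_of_succ_lt hj⟩ b)
  | right_var (j : ℕ) (hj : j + 1 < n) (b : ZMod 2) :
      Edge φ (.right j hj) (.var ⟨j + 1, hj⟩ b)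

/-- The graph `G_φ`. -/
def graph (φ : XorSystem n) : SimpleGraph φ.Vertex := SimpleGraph.fromRel φ.Edge

instance (φ : XorSystem n) : Finite φ.Clause := by
  have : Finite {c : XorEq n × Finset (Fin n) // c.1 ∈ φ} :=
    Finite.of_injective
      (β := {e // e ∈ φ} × Finset (Fin n)) (fun c => (⟨c.1.1, c.2⟩, c.1.2)) (by
        rintro ⟨⟨a, b⟩, h⟩ ⟨⟨c, d⟩, h'⟩ hh
        simpa using hh)
  exact Finite.of_injective
    (β := {c : XorEq n × Finset (Fin n) // c.1 ∈ φ}) (fun c => ⟨c.1, c.2.1⟩) (by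
      rintro ⟨a, h⟩ ⟨b, h'⟩ hh
      exact Subtype.ext (congrArg (fun c => c.1) hh))

instance (φ : XorSystem n) : Finite φ.Vertex :=
  Finite.of_surjective
    (α := φ.Clause ⊕ (Fin n × ZMod 2) ⊕ {j : Fin n // j.1 + 1 < n} ⊕
      {j : Fin n // j.1 + 1 < n} ⊕ {j : Fin n // j.1 + 1 < n})
    (fun x => match x with
      | .inl c => .clause c
      | .inr (.inl p) => .var p.1 p.2
      | .inr (.inr (.inl j)) => .left j.1 j.2
      | .inr (.inr (.inr (.inl j))) => .right j.1 j.2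
      | .inr (.inr (.inr (.inr j))) => .stub j.1 j.2) (by
    intro v
    cases v with
    | clause c => exact ⟨.inl c, rfl⟩
    | var X b => exact ⟨.inr (.inl (X, b)), rfl⟩
    | left j hj => exact ⟨.inr (.inr (.inl ⟨⟨j, Nat.lt_of_succ_lt hj⟩, hj⟩)), rfl⟩
    | right j hj => exact ⟨.inr (.inr (.inr (.inl ⟨⟨j, Nat.lt_of_succ_lt hj⟩, hj⟩))), rfl⟩
    | stub j hj => exact ⟨.inr (.inr (.inr (.inr ⟨⟨j, Nat.lt_of_succ_lt hj⟩, hj⟩))), rfl⟩)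

end XorSystem

/-! ### The Weisfeiler-Leman equivalence -/

namespace WeisfeilerLeman

variable {V : Type*} [Finite V]

/-- A partition of `V^k`, given as an equivalence relation, is stable if for any two tuples
`u, v` in the same part the map `u_a ↦ v_a` is an isomorphism of the induced subgraphs, and for
all parts `P_1, …, P_k` the number of vertices `x` with `u[x/a] ∈ P_a` for all `a` is the same as
for `v`. -/
def IsStable (G : SimpleGraph V) (k : ℕ) (r : Setoid (Fin k → V)) : Prop :=
  ∀ u v : Fin k → V, r u v →
    (∀ a b, (u a = u b ↔ v a = v b) ∧ (G.Adj (u a) (u b) ↔ G.Adj (v a) (v b))) ∧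
    ∀ P : Fin k → Set (Fin k → V), (∀ a, P a ∈ r.classes) →
      {x : V | ∀ a, Function.update u a x ∈ P a}.ncard =
        {x : V | ∀ a, Function.update v a x ∈ P a}.ncard

/-- The relation `≡^k`: the coarsest stable partition of `V^k` (see `wlSetoid_isGreatest`). -/
def wlSetoid (G : SimpleGraph V) (k : ℕ) : Setoid (Fin k → V) :=
  sSup {r | IsStable G k r}

/-- The join of all stable partitions is stable, so that it is the coarsest stable partition. -/
theorem wlSetoid_isGreatest (G : SimpleGraph V) (k : ℕ) :
    IsGreatest {r | IsStable G k r} (wlSetoid G k) := by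
  refine ⟨?_, fun r hr => le_sSup hr⟩
  have key : ∀ r, IsStable G k r → ∀ u v : Fin k → V, r u v →
      ∃ π : V ≃ V, ∀ x a, r (Function.update u a x) (Function.update v a (π x)) := by
    intro r hr u v huv
    let f : (Fin k → V) → V → (Fin k → Quotient r) := fun w x a => ⟦Function.update w a x⟧
    have hc : ∀ c : Fin k → Quotient r, Nonempty ({x // f u x = c} ≃ {x // f v x = c}) := by
      intro c
      have h := (hr u v huv).2 (fun a => {w | r w (c a).out})
        (fun a => r.mem_classes _)
      have hs : ∀ w, {x | ∀ a, Function.update w a x ∈ {w' | r w' (c a).out}} =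
          {x | f w x = c} := by
        intro w
        ext x
        simp only [Set.mem_ofPred_eq, funext_iff, f]
        refine forall_congr' fun a => ?_
        conv_rhs => rw [← Quotient.out_eq (c a)]
        exact Quotient.eq.symm
      rw [hs, hs, ← Nat.card_coe_set_eq, ← Nat.card_coe_set_eq] at h
      exact ⟨(Finite.card_eq.mp h).some⟩
    refine ⟨Equiv.ofFiberEquiv (f := f u) (g := f v) fun c => (hc c).some, fun x a => ?_⟩
    have h := Equiv.ofFiberEquiv_map (f := f u) (g := f v) (fun c => (hc c).some) x
    exact r.symm (Quotient.eq.mp (congrFun h a))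
  intro u v huv
  have huv' := huv
  rw [wlSetoid, Setoid.sSup_eq_eqvGen] at huv'
  change Relation.EqvGen _ u v at huv'
  induction huv' with
  | rel u v h =>
    obtain ⟨r, hr, h⟩ := h
    refine ⟨(hr u v h).1, fun P hP => ?_⟩
    obtain ⟨π, hπ⟩ := key r hr u v h
    have hle : r ≤ wlSetoid G k := le_sSup hr
    refine Set.ncard_congr (fun x _ => π x) ?_ (fun _ _ _ _ h => π.injective h) ?_
    · intro x hx a
      obtain ⟨w, hw⟩ := hP a
      have h1 := hx a
      rw [hw] at h1 ⊢
      exact (wlSetoid G k).trans ((wlSetoid G k).symm (hle (hπ x a))) h1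
    · intro y hy
      refine ⟨π.symm y, fun a => ?_, by simp⟩
      obtain ⟨w, hw⟩ := hP a
      have h1 := hy a
      have h2 := hle (hπ (π.symm y) a)
      rw [π.apply_symm_apply] at h2
      rw [hw] at h1 ⊢
      exact (wlSetoid G k).trans h2 h1
  | refl u => exact ⟨fun _ _ => ⟨Iff.rfl, Iff.rfl⟩, fun _ _ => rfl⟩
  | symm u v h ih =>
    have := ih ((wlSetoid G k).symm huv)
    exact ⟨fun a b => ⟨(this.1 a b).1.symm, (this.1 a b).2.symm⟩,
      fun P hP => (this.2 P hP).symm⟩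
  | trans u v w h1 h2 ih1 ih2 =>
    have e1 : wlSetoid G k u v := by
      rw [wlSetoid, Setoid.sSup_eq_eqvGen]; exact h1
    have e2 : wlSetoid G k v w := by
      rw [wlSetoid, Setoid.sSup_eq_eqvGen]; exact h2
    have i1 := ih1 e1
    have i2 := ih2 e2
    exact ⟨fun a b => ⟨(i1.1 a b).1.trans (i2.1 a b).1, (i1.1 a b).2.trans (i2.1 a b).2⟩,
      fun P hP => (i1.2 P hP).trans (i2.2 P hP)⟩

/-- `x ≡^k y` for single vertices: the `k`-tuples `(x, …, x)` and `(y, …, y)` are equivalent. -/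
def VertexEquiv (G : SimpleGraph V) (k : ℕ) (x y : V) : Prop :=
  wlSetoid G k (fun _ => x) (fun _ => y)

end WeisfeilerLeman

/-!
The proof plays the bijective pebble game on `φ.graph` against a winning strategy for the
local consistency game of `φ.addEqOne i`.

An assignment `f` of the variables acts on the vertices by an involution `flip f`, which exchanges
`X^0` and `X^1` when `f X = 1`, and moves the clauses of an equation accordingly whenever `f`
solves the homogeneous form of that equation. It preserves adjacency between vertices whose
equations are solved by `f` (`adj_flip_iff`). Call `f` realized on a set `S` of variables if its
values on `S` are pebbled in some play that follows the strategy. A realized assignment satisfies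
every equation inside `S`, and it can be extended to further variables as long as there are pebbles
left (`Realized.extend`).

Relate two tuples `u` and `v` if `v` is the image of `u` under `flip f` for some `f` realized on the
at most `3 * k` variables of `u`. Given such an `f`, extend it to the at most three variables of a
further vertex `x`, with a choice that depends only on this set of variables, and let `x` be moved
by the extension. As `flip` preserves the set of variables, this map is an involution of the set of
vertices, hence a bijection, and it turns related tuples into related tuples when one entry is
replaced. So the relation has the back-and-forth property and is contained in `≡^k`
(`wlSetoid_of_backAndForth`). Finally, an assignment realized on `{i}` has the value `1` at `i`
because of the additional equation, and therefore exchanges `X_i^0` and `X_i^1`.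
-/

/-! ### Back-and-forth relations -/

namespace WeisfeilerLeman

variable {V : Type*}

/-- A relation on tuples consists of equivalent tuples if it respects the induced subgraphs and if,
for related tuples, some bijection of the vertices allows any entry to be replaced. The relation
need not be an equivalence: the partition that it generates is stable. -/
theorem wlSetoid_of_backAndForth (G : SimpleGraph V) (k : ℕ)
    (R : (Fin k → V) → (Fin k → V) → Prop)
    (hiso : ∀ u v, R u v → ∀ a b,
      (u a = u b ↔ v a = v b) ∧ (G.Adj (u a) (u b) ↔ G.Adj (v a) (v b)))
    (hbij : ∀ u v, R u v →
      ∃ π : V ≃ V, ∀ x a, R (Function.update u a x) (Function.update v a (π x)))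
    {u v : Fin k → V} (h : R u v) : wlSetoid G k u v := by
  have hstable : IsStable G k (Relation.EqvGen.setoid R) := by
    intro u v huv
    change Relation.EqvGen R u v at huv
    induction huv with
    | rel u v h =>
      refine ⟨hiso u v h, fun P hP => ?_⟩
      obtain ⟨π, hπ⟩ := hbij u v h
      have hmem : ∀ x a, Function.update u a x ∈ P a ↔ Function.update v a (π x) ∈ P a := by
        intro x a
        obtain ⟨w, hw⟩ := hP a
        have hx : (Relation.EqvGen.setoid R) (Function.update u a x) (Function.update v a (π x)) :=
          Relation.EqvGen.rel _ _ (hπ x a)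
        rw [hw]
        exact ⟨fun h1 => (Relation.EqvGen.setoid R).trans ((Relation.EqvGen.setoid R).symm hx) h1,
          fun h1 => (Relation.EqvGen.setoid R).trans hx h1⟩
      refine Set.ncard_congr (fun x _ => π x) (fun x hx a => (hmem x a).1 (hx a))
        (fun _ _ _ _ h => π.injective h) (fun y hy => ⟨π.symm y, fun a => ?_, by simp⟩)
      rw [hmem, π.apply_symm_apply]
      exact hy a
    | refl u => exact ⟨fun _ _ => ⟨Iff.rfl, Iff.rfl⟩, fun _ _ => rfl⟩
    | symm u v _ ih =>
      exact ⟨fun a b => ⟨(ih.1 a b).1.symm, (ih.1 a b).2.symm⟩, fun P hP => (ih.2 P hP).symm⟩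
    | trans u v w _ _ ih1 ih2 =>
      exact ⟨fun a b => ⟨(ih1.1 a b).1.trans (ih2.1 a b).1, (ih1.1 a b).2.trans (ih2.1 a b).2⟩,
        fun P hP => (ih1.2 P hP).trans (ih2.2 P hP)⟩
  have hle : Relation.EqvGen.setoid R ≤ wlSetoid G k := le_sSup hstable
  exact hle (Relation.EqvGen.rel _ _ h)

end WeisfeilerLeman

namespace XorSystem

variable {n : ℕ}

/-! ### Assignments realized by a strategy -/

/-- The values of `f` on `S` are pebbled at some moment of a play in which Verifier follows `σ`.
Spoiler may only pebble variables that appear in `ψ`, so nothing is required of the others. -/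
def Realized {K : ℕ} (ψ : XorSystem n) (σ : Strategy K n) (S : Finset (Fin n))
    (f : Fin n → ZMod 2) : Prop :=
  ∃ h : List (Move K n), (∀ m ∈ h, ψ.Appears m.2) ∧
    ∀ X ∈ S, ψ.Appears X → ∃ a, σ.position h a = some (X, f X)

namespace Realized

variable {K : ℕ} {ψ : XorSystem n} {σ : Strategy K n} {S T : Finset (Fin n)} {f g : Fin n → ZMod 2}

theorem empty (f : Fin n → ZMod 2) : Realized ψ σ ∅ f := ⟨[], by simp, by simp⟩

theorem mono (hf : Realized ψ σ S f) (hT : T ⊆ S) : Realized ψ σ T f := by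
  obtain ⟨h, hh, hp⟩ := hf
  exact ⟨h, hh, fun X hX => hp X (hT hX)⟩

theorem sum_eq (hσ : ∀ h : List (Move K n), (∀ m ∈ h, ψ.Appears m.2) → (σ.position h).Safe ψ)
    (hf : Realized ψ σ S f) {e : XorEq n} (he : e ∈ ψ) (hS : e.support ⊆ S) :
    ∑ X ∈ e.support, f X = e.rhs := by
  obtain ⟨h, hh, hp⟩ := hf
  exact (hσ h hh).2 e he f fun X hX => hp X (hS hX) ⟨e, he, hX⟩

theorem extend_insert (hf : Realized ψ σ S f) (hS : S.card < K) (X : Fin n) :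
    ∃ g, (∀ Y ∈ S, g Y = f Y) ∧ Realized ψ σ (insert X S) g := by
  classical
  obtain ⟨h, hh, hp⟩ := hf
  by_cases hX : ψ.Appears X ∧ X ∉ S
  · -- One pebble is kept on each variable of `S`; some other pebble is free to be put on `X`.
    have : Nonempty (Fin K) := ⟨⟨0, by omega⟩⟩
    choose! a ha using hp
    obtain ⟨c, hc⟩ : ∃ c, c ∉ S.image a := by
      by_contra! hall
      have h1 : (Finset.univ : Finset (Fin K)).card ≤ (S.image a).card :=
        Finset.card_le_card fun c _ => hall c
      have h2 := Finset.card_image_le (s := S) (f := a)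
      simp only [Finset.card_univ, Fintype.card_fin] at h1
      omega
    refine ⟨Function.update f X (σ ((c, X) :: h)), fun Y hY => ?_, (c, X) :: h, ?_, ?_⟩
    · exact Function.update_of_ne (fun hYX : Y = X => hX.2 (hYX ▸ hY)) _ _
    · simpa using ⟨hX.1, fun m b hm => hh (m, b) hm⟩
    · intro Y hY hYapp
      rcases Finset.mem_insert.1 hY with rfl | hYS
      · exact ⟨c, by simp [Strategy.position]⟩
      · have hYX : Y ≠ X := fun hYX => hX.2 (hYX ▸ hYS)
        have hac : a Y ≠ c := fun hac => hc (hac ▸ Finset.mem_image_of_mem a hYS)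
        refine ⟨a Y, ?_⟩
        simp [Strategy.position, Function.update_of_ne hac, Function.update_of_ne hYX,
          ha Y hYS hYapp]
  · refine ⟨f, fun _ _ => rfl, h, hh, fun Y hY hYapp => ?_⟩
    rcases Finset.mem_insert.1 hY with rfl | hYS
    · exact hp Y (by_contra fun hYS => hX ⟨hYapp, hYS⟩) hYapp
    · exact hp Y hYS hYapp

theorem extend (hf : Realized ψ σ S f) (T : Finset (Fin n)) (hST : S.card + T.card ≤ K) :
    ∃ g, (∀ Y ∈ S, g Y = f Y) ∧ Realized ψ σ (S ∪ T) g := by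
  classical
  induction T using Finset.induction_on with
  | empty => exact ⟨f, fun _ _ => rfl, by simpa using hf⟩
  | insert X T hX ih =>
    rw [Finset.card_insert_of_notMem hX] at hST
    obtain ⟨g, hg, hgr⟩ := ih (by omega)
    have hcard := Finset.card_union_le S T
    obtain ⟨g', hg', hgr'⟩ := hgr.extend_insert (by omega) X
    refine ⟨g', fun Y hY => (hg' Y (Finset.mem_union_left _ hY)).trans (hg Y hY), ?_⟩
    rwa [Finset.union_insert]

end Realized

/-! ### The action of an assignment on the graph -/

variable {φ : XorSystem n}

/-- The variables that a vertex stands for. The vertices `j_l`, `j_r`, `j_s` stand for none: they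
are fixed by the action of every assignment. -/
def Vertex.vars : φ.Vertex → Finset (Fin n)
  | .clause c => c.1.1.support
  | .var X _ => {X}
  | _ => ∅

theorem card_symmDiff_zmod_two {α : Type*} [DecidableEq α] (s t : Finset α) :
    ((symmDiff s t).card : ZMod 2) = s.card + t.card := by
  have h1 : (symmDiff s t).card = (s \ t).card + (t \ s).card := by
    rw [symmDiff_def, Finset.sup_eq_union, Finset.card_union_of_disjoint disjoint_sdiff_sdiff]
  have h2 := Finset.card_sdiff_add_card_inter s t
  have h3 := Finset.card_sdiff_add_card_inter t s
  rw [Finset.inter_comm] at h3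
  rw [h1, ← h2, ← h3]
  push_cast
  linear_combination -CharTwo.add_self_eq_zero ((s ∩ t).card : ZMod 2)

theorem card_filter_eq_one {α : Type*} (s : Finset α) (f : α → ZMod 2) :
    ((s.filter (fun X => f X = 1)).card : ZMod 2) = ∑ X ∈ s, f X := by
  rw [Finset.card_filter]
  push_cast
  refine Finset.sum_congr rfl fun X _ => ?_
  generalize f X = b
  revert b
  decide

/-- Negate additionally the variables of the clause on which `f` is `1`. The parity condition on
clauses is preserved because there is an even number of them. -/
def Clause.flip (f : Fin n → ZMod 2) (c : φ.Clause) (h : ∑ X ∈ c.1.1.support, f X = 0) :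
    φ.Clause :=
  ⟨(c.1.1, symmDiff c.1.2 (c.1.1.support.filter (fun X => f X = 1))), c.2.1,
    fun X hX => by
      rcases Finset.mem_symmDiff.1 hX with hX | hX
      · exact c.2.2.1 hX.1
      · exact (Finset.mem_filter.1 hX.1).1,
    by rw [card_symmDiff_zmod_two, card_filter_eq_one, h, add_zero, c.2.2.2]⟩

/-- The action of the assignment `f` on the vertices: `X^b` goes to `X^(b + f X)`, clauses move
accordingly. Clauses of equations whose homogeneous form is violated by `f` are left fixed, so that
the action is an involution for every `f`. -/
def Vertex.flip (f : Fin n → ZMod 2) : φ.Vertex → φ.Vertex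
  | .clause c => if h : ∑ X ∈ c.1.1.support, f X = 0 then .clause (c.flip f h) else .clause c
  | .var X b => .var X (b + f X)
  | .left j hj => .left j hj
  | .right j hj => .right j hj
  | .stub j hj => .stub j hj

@[simp]
theorem Vertex.vars_flip (f : Fin n → ZMod 2) (x : φ.Vertex) : (x.flip f).vars = x.vars := by
  cases x with
  | clause c =>
    simp only [Vertex.flip]
    split_ifs <;> rfl
  | _ => rfl

@[simp]
theorem Vertex.flip_flip (f : Fin n → ZMod 2) (x : φ.Vertex) : (x.flip f).flip f = x := by
  cases x with
  | clause c =>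
    by_cases h : ∑ X ∈ c.1.1.support, f X = 0
    · have h' : ∑ X ∈ (c.flip f h).1.1.support, f X = 0 := h
      simp only [Vertex.flip, dif_pos h, dif_pos h']
      congr 1
      refine Subtype.ext (Prod.ext rfl ?_)
      simp [Clause.flip]
    · simp only [Vertex.flip, dif_neg h]
  | var X b => simp [Vertex.flip, add_assoc, CharTwo.add_self_eq_zero]
  | _ => rfl

theorem Vertex.flip_injective (f : Fin n → ZMod 2) :
    Function.Injective (Vertex.flip f : φ.Vertex → φ.Vertex) :=
  (show Function.Involutive (Vertex.flip f) from Vertex.flip_flip f).injective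

theorem Vertex.flip_congr {f g : Fin n → ZMod 2} {x : φ.Vertex} (h : ∀ X ∈ x.vars, f X = g X) :
    x.flip f = x.flip g := by
  cases x with
  | clause c =>
    have hsum : ∑ X ∈ c.1.1.support, f X = ∑ X ∈ c.1.1.support, g X := Finset.sum_congr rfl h
    have hfilter : c.1.1.support.filter (fun X => f X = 1) =
        c.1.1.support.filter (fun X => g X = 1) :=
      Finset.filter_congr fun X hX => by rw [h X hX]
    by_cases hf : ∑ X ∈ c.1.1.support, f X = 0
    · have hg := hf
      rw [hsum] at hg
      simp only [Vertex.flip, dif_pos hf, dif_pos hg]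
      simp only [Clause.flip, hfilter]
    · have hg := hf
      rw [hsum] at hg
      simp only [Vertex.flip, dif_neg hf, dif_neg hg]
  | var X b => simp [Vertex.flip, h X (Finset.mem_singleton_self X)]
  | _ => rfl

/-- The homogeneous forms of the equations to which the vertex belongs are solved by `f`; this
constrains only clauses. -/
def Vertex.Solved (f : Fin n → ZMod 2) (x : φ.Vertex) : Prop :=
  ∀ c, x = .clause c → ∑ X ∈ c.1.1.support, f X = 0

theorem Vertex.Solved.flip {f : Fin n → ZMod 2} {x : φ.Vertex} (h : x.Solved f) :
    (x.flip f).Solved f := by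
  cases x with
  | clause c =>
    intro d hd
    simp only [Vertex.flip, dif_pos (h c rfl), Vertex.clause.injEq] at hd
    rw [← hd]
    exact h c rfl
  | _ => intro d hd; simp [Vertex.flip] at hd

theorem Edge.adj {x y : φ.Vertex} (h : φ.Edge x y) : φ.graph.Adj x y := by
  refine (SimpleGraph.fromRel_adj _ _ _).2 ⟨?_, Or.inl h⟩
  rintro rfl
  cases h

theorem Edge.adj_flip {f : Fin n → ZMod 2} {x y : φ.Vertex} (h : φ.Edge x y)
    (hx : x.Solved f) : φ.graph.Adj (x.flip f) (y.flip f) := by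
  have hf : ∀ X : Fin n, f X = 0 ∨ f X = 1 := fun X => by
    generalize f X = b
    revert b
    decide
  cases h with
  | pos c X hX hs =>
    simp only [Vertex.flip, dif_pos (hx c rfl)]
    rcases hf X with h0 | h1
    · rw [h0]
      refine (Edge.pos (c.flip f _) X hX ?_).adj
      simp [Clause.flip, Finset.mem_symmDiff, hs, h0]
    · rw [h1]
      refine (Edge.neg (c.flip f _) X hX ?_).adj
      simp [Clause.flip, Finset.mem_symmDiff, hs, h1, hX]
  | neg c X hX hs =>
    simp only [Vertex.flip, dif_pos (hx c rfl)]
    rcases hf X with h0 | h1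
    · rw [h0]
      refine (Edge.neg (c.flip f _) X hX ?_).adj
      simp [Clause.flip, Finset.mem_symmDiff, hs, h0]
    · rw [h1]
      refine (Edge.pos (c.flip f _) X hX ?_).adj
      simp [Clause.flip, Finset.mem_symmDiff, hs, h1, hX]
  | pair X =>
    rcases hf X with h0 | h1
    · simpa only [Vertex.flip, h0, add_zero] using (Edge.pair X).adj
    · simpa only [Vertex.flip, h1, zero_add, CharTwo.add_self_eq_zero] using (Edge.pair X).adj.symm
  | left_right j hj => exact (Edge.left_right j hj).adj
  | right_stub j hj => exact (Edge.right_stub j hj).adj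
  | left_var j hj b => exact (Edge.left_var j hj _).adj
  | right_var j hj b => exact (Edge.right_var j hj _).adj

theorem adj_flip {f : Fin n → ZMod 2} {x y : φ.Vertex} (hx : x.Solved f) (hy : y.Solved f)
    (h : φ.graph.Adj x y) : φ.graph.Adj (x.flip f) (y.flip f) := by
  rcases ((SimpleGraph.fromRel_adj _ _ _).1 h).2 with h | h
  · exact h.adj_flip hx
  · exact (h.adj_flip hy).symm

theorem adj_flip_iff {f : Fin n → ZMod 2} {x y : φ.Vertex} (hx : x.Solved f) (hy : y.Solved f) :
    φ.graph.Adj x y ↔ φ.graph.Adj (x.flip f) (y.flip f) := by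
  refine ⟨adj_flip hx hy, fun h => ?_⟩
  simpa using adj_flip hx.flip hy.flip h

/-! ### Related tuples -/

/-- The variables of the entries of a tuple of vertices. -/
def tupleVars {k : ℕ} (u : Fin k → φ.Vertex) : Finset (Fin n) :=
  Finset.univ.biUnion fun a => (u a).vars

theorem vars_subset_tupleVars {k : ℕ} (u : Fin k → φ.Vertex) (a : Fin k) :
    (u a).vars ⊆ tupleVars u :=
  Finset.subset_biUnion_of_mem (fun a => (u a).vars) (Finset.mem_univ a)

theorem tupleVars_update_subset {k : ℕ} (u : Fin k → φ.Vertex) (a : Fin k) (x : φ.Vertex) :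
    tupleVars (Function.update u a x) ⊆ tupleVars u ∪ x.vars := by
  refine Finset.biUnion_subset.2 fun b _ => ?_
  rcases eq_or_ne b a with rfl | hb
  · simp
  · rw [Function.update_of_ne hb]
    exact (vars_subset_tupleVars u b).trans Finset.subset_union_left

theorem IsThreeXor.card_vars_le (h : φ.IsThreeXor) (x : φ.Vertex) : x.vars.card ≤ 3 := by
  cases x with
  | clause c => exact (h _ c.2.1).le
  | _ => simp [Vertex.vars]

theorem IsThreeXor.card_tupleVars_le (h : φ.IsThreeXor) {k : ℕ} (u : Fin k → φ.Vertex) :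
    (tupleVars u).card ≤ 3 * k := by
  refine (Finset.card_biUnion_le_card_mul _ _ 3 fun a _ => h.card_vars_le (u a)).trans ?_
  simp [mul_comm]

/-- The tuple `v` is the image of `u` under an assignment realized by `σ` on the variables
of `u`. -/
def FlipRelated {K : ℕ} (ψ : XorSystem n) (σ : Strategy K n) {k : ℕ} (u v : Fin k → φ.Vertex) :
    Prop :=
  ∃ f, Realized ψ σ (tupleVars u) f ∧ ∀ a, v a = (u a).flip f

theorem FlipRelated.exists_equiv {k : ℕ} (h : φ.IsThreeXor) {ψ : XorSystem n}
    {σ : Strategy (3 * (k + 1)) n} {u v : Fin k → φ.Vertex} (huv : FlipRelated ψ σ u v) :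
    ∃ π : φ.Vertex ≃ φ.Vertex, ∀ x a,
      FlipRelated ψ σ (Function.update u a x) (Function.update v a (π x)) := by
  obtain ⟨f, hf, hv⟩ := huv
  have hext : ∀ T : Finset (Fin n), T.card ≤ 3 →
      ∃ g, (∀ Y ∈ tupleVars u, g Y = f Y) ∧ Realized ψ σ (tupleVars u ∪ T) g := fun T hT =>
    hf.extend T (by have := h.card_tupleVars_le u; omega)
  -- The extension depends only on the set of variables, so `x` and its image use the same one.
  choose! g hgf hg using hext
  have hinv : Function.Involutive fun x : φ.Vertex => x.flip (g x.vars) := fun x => by simp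
  refine ⟨hinv.toPerm, fun x a => ⟨g x.vars,
    (hg _ (h.card_vars_le x)).mono (tupleVars_update_subset u a x), fun b => ?_⟩⟩
  rcases eq_or_ne b a with rfl | hb
  · simp
  · rw [Function.update_of_ne hb, Function.update_of_ne hb, hv]
    exact Vertex.flip_congr fun X hX =>
      (hgf _ (h.card_vars_le x) X (vars_subset_tupleVars u b hX)).symm

theorem FlipRelated.iso {K k : ℕ} (h_hom : φ.IsHomogeneous) {ψ : XorSystem n} (hφψ : φ ⊆ ψ)
    {σ : Strategy K n}
    (hσ : ∀ h : List (Move K n), (∀ m ∈ h, ψ.Appears m.2) → (σ.position h).Safe ψ)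
    {u v : Fin k → φ.Vertex} (huv : FlipRelated ψ σ u v) (a b : Fin k) :
    (u a = u b ↔ v a = v b) ∧ (φ.graph.Adj (u a) (u b) ↔ φ.graph.Adj (v a) (v b)) := by
  obtain ⟨f, hf, hv⟩ := huv
  have hsolved : ∀ a, (u a).Solved f := fun a c hc => by
    rw [← h_hom _ c.2.1]
    refine hf.sum_eq hσ (hφψ c.2.1) ?_
    have hsub := vars_subset_tupleVars u a
    rwa [hc] at hsub
  rw [hv, hv]
  exact ⟨(Vertex.flip_injective f).eq_iff.symm, adj_flip_iff (hsolved a) (hsolved b)⟩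

end XorSystem

open XorSystem in
theorem mainTheorem3 {n : ℕ} (φ : XorSystem n) (h_three : φ.IsThreeXor)
    (h_hom : φ.IsHomogeneous) (k : ℕ) (hk : 2 ≤ k) (i : Fin n)
    (h_cons : (φ.addEqOne i).LocallyConsistent (3 * (k + 1))) :
    WeisfeilerLeman.VertexEquiv φ.graph k (.var i 0) (.var i 1) := by
  obtain ⟨σ, hσ⟩ := h_cons
  refine WeisfeilerLeman.wlSetoid_of_backAndForth φ.graph k (FlipRelated (φ.addEqOne i) σ)
    (fun u v huv => huv.iso h_hom (Finset.subset_insert _ _) hσ)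
    (fun u v huv => huv.exists_equiv h_three) ?_
  obtain ⟨f, -, hf⟩ := (Realized.empty (ψ := φ.addEqOne i) (σ := σ) 0).extend {i}
    (by simp; omega)
  rw [Finset.empty_union] at hf
  have hi : f i = 1 := by
    simpa using hf.sum_eq hσ (Finset.mem_insert_self ⟨{i}, 1⟩ φ) (Finset.Subset.refl _)
  refine ⟨f, hf.mono ?_, fun _ => by simp [Vertex.flip, hi]⟩
  exact Finset.biUnion_subset.2 fun _ _ => Finset.Subset.refl _
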